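/- Let $\kappa\in\{-1,0,1\}$, let $\mathbb{M}(\kappa)$ be the complete simply connected surface of constant curvature $\kappa$ with metric $g_2$ (hyperbolic plane, Euclidean plane or unit sphere), let $I\subset\mathbb{R}$ be an open interval, $f:I\to\mathbb{R}$ smooth, and let $\mathbb{M}(\kappa)_f\times I$ be the product $\mathbb{M}(\kappa)\times I$ with the metric $\overline g=e^{2f}g_2+dt^2$ and Levi-Civita connection $\overline\nabla$. Let $\varphi:\Sigma\to\mathbb{M}(\kappa)_f\times I$ be a smooth immersion of a surface with a smooth unit normal field $N$ and induced metric $g$, and decompose the vertical field $\xi=\partial_t$ along $\Sigma$ as $\xi=T+\nu N$ with $T$ tangent to $\Sigma$. Suppose that $\Sigma$ is totally umbilical, with smooth umbilicity function $\varrho:\Sigma\to\mathbb{R}$, in the sense that $\overline\nabla_XN=\varrho X$ for all tangent vectors $X$ of $\Sigma$. Then the gradient of $\varrho$ with respect to $g$ is $$\mathrm{grad}(\varrho)=\nu\,(f''+\kappa e^{-2f})\,T .$$ Equivalently, in any local isothermal coordinates $(u,v)$ of $\Sigma$, with $g=\frac1\eta(du^2+dv^2)$, $\eta>0$, one has $$\eta\,(\varrho_u\,\partial_u+\varrho_v\,\partial_v)=\nu\,(f''+\kappa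 e^{-2f})\,T .$$ (Here $f$ and $f''$ are evaluated at the height $t$ of the point. With the opposite sign convention $-\overline\nabla_XN=\varrho X$, the right sides of both formulas change sign.) In particular, if $\Sigma$ is connected and $f''+\kappa e^{-2f}=0$ along $\Sigma$, then $\varrho$ is constant. -/

import Mathlib

open scoped Manifold ContDiff

noncomputable section

/-- The linear space `ℝ³ × ℝ` which contains all the ambient manifolds `M(κ) × I`. (Its norm plays
no role: it only serves to differentiate.) -/
abbrev AmbientSpace : Type := (Fin 3 → ℝ) × ℝ

/-- The standard model of the complete simply connected surface `M(κ)` of constant curvature `κ`,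
for `κ ∈ {-1, 0, 1}`: the unit sphere `x² + y² + z² = 1` for `κ = 1`, the plane `z = 1` for `κ = 0`,
the upper sheet `z² - x² - y² = 1`, `z > 0` of the hyperboloid for `κ = -1`. -/
def spaceForm (κ : ℝ) : Set (Fin 3 → ℝ) :=
  {q | κ * (q 0 ^ 2 + q 1 ^ 2) + q 2 ^ 2 = 1 ∧ (κ ≤ 0 → 0 < q 2)}

/-- The bilinear form `dx² + dy² + κ dz²` on `ℝ³`. Its restriction to the tangent planes of
`spaceForm κ` is the Riemannian metric `g₂` of `M(κ)`: round, Euclidean (where `dz = 0`) or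
hyperbolic. -/
def spaceFormMetric (κ : ℝ) (v w : Fin 3 → ℝ) : ℝ :=
  v 0 * w 0 + v 1 * w 1 + κ * (v 2 * w 2)

/-- The tangent space of `M(κ) × I` at `x = (q, t)`, as a subset of `ℝ³ × ℝ`: the vectors whose
first component is in the kernel of the differential at `q` of the equation of `M(κ)`. -/
def ambientTangent (κ : ℝ) (x : AmbientSpace) : Set AmbientSpace :=
  {v | κ * (x.1 0 * v.1 0 + x.1 1 * v.1 1) + x.1 2 * v.1 2 = 0}

/-- The warped product metric `e^{2f} g₂ + dt²` of `M(κ)_f × I` at the point `x = (q, t)`. -/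
def warpedMetric (κ : ℝ) (f : ℝ → ℝ) (x v w : AmbientSpace) : ℝ :=
  Real.exp (2 * f x.2) * spaceFormMetric κ v.1 w.1 + v.2 * w.2

/-- The vertical unit field `ξ = ∂_t` of `M(κ)_f × I`. -/
def verticalField : AmbientSpace := (0, 1)

/-- The derivative of the coefficient `y ↦ G y v w` of a field `G` of bilinear forms, at `x` in the
direction `u`. -/
def metricDeriv (G : AmbientSpace → AmbientSpace → AmbientSpace → ℝ) (x u v w : AmbientSpace) : ℝ :=
  fderiv ℝ (fun y => G y v w) x u

section Surface

variable {S : Type*} [TopologicalSpace S] [ChartedSpace (EuclideanSpace ℝ (Fin 2)) S]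

/-- The differential of a map from the surface `S` to `ℝ³ × ℝ`, at `p`. -/
def surfaceDiff (φ : S → AmbientSpace) (p : S) (X : TangentSpace (𝓡 2) p) : AmbientSpace :=
  mfderiv (𝓡 2) 𝓘(ℝ, AmbientSpace) φ p X

/-- The differential of a real function on the surface `S`, at `p`. -/
def surfaceDiffFun (h : S → ℝ) (p : S) (X : TangentSpace (𝓡 2) p) : ℝ :=
  mfderiv (𝓡 2) 𝓘(ℝ, ℝ) h p X

/-- The differential `(du(X), dv(X))` of a chart `c = (u, v)` of the surface `S`, at `p`. -/
def chartDiff (c : OpenPartialHomeomorph S (EuclideanSpace ℝ (Fin 2))) (p : S)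
    (X : TangentSpace (𝓡 2) p) : EuclideanSpace ℝ (Fin 2) :=
  mfderiv (𝓡 2) 𝓘(ℝ, EuclideanSpace ℝ (Fin 2)) c p X

/-- `φ` is a smooth immersion of the surface `S` into `M(κ) × I`. -/
structure IsSurfaceImmersion (κ : ℝ) (I : Set ℝ) (φ : S → AmbientSpace) : Prop where
  smooth : ContMDiff (𝓡 2) 𝓘(ℝ, AmbientSpace) ∞ φ
  mem_spaceForm : ∀ p, (φ p).1 ∈ spaceForm κ
  mem_interval : ∀ p, (φ p).2 ∈ I
  injective_diff : ∀ p, Function.Injective (surfaceDiff φ p)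

/-- The metric on the surface `S` induced by `φ` from the warped product metric. -/
def inducedMetric (κ : ℝ) (f : ℝ → ℝ) (φ : S → AmbientSpace) (p : S)
    (X Y : TangentSpace (𝓡 2) p) : ℝ :=
  warpedMetric κ f (φ p) (surfaceDiff φ p X) (surfaceDiff φ p Y)

/-- `N` is a smooth unit normal field along the immersion `φ` into `M(κ)_f × I`. -/
structure IsUnitNormalField (κ : ℝ) (f : ℝ → ℝ) (φ N : S → AmbientSpace) : Prop where
  smooth : ContMDiff (𝓡 2) 𝓘(ℝ, AmbientSpace) ∞ N
  tangent : ∀ p, N p ∈ ambientTangent κ (φ p)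
  unit : ∀ p, warpedMetric κ f (φ p) (N p) (N p) = 1
  normal : ∀ p (X : TangentSpace (𝓡 2) p),
    warpedMetric κ f (φ p) (N p) (surfaceDiff φ p X) = 0

/-- `W = ∇̄_X V` at `p`, where `∇̄` is the Levi-Civita connection of `M(κ)_f × I`, `V` is a vector
field along `φ` tangent to `M(κ) × I`, and `X` is a tangent vector of `S` at `p`: `W` is tangent to
`M(κ) × I`, and for every vector `Z` tangent to `M(κ) × I` at `φ p`, with `Y = dφ(X)` and
`G` the metric,
`G(W, Z) = G(dV(X), Z) + (1/2) (∂_Y G (V, Z) + ∂_V G (Y, Z) - ∂_Z G (Y, V))`.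
This is the Christoffel (Koszul) formula for the covariant derivative; its right side is invariant
under reparametrization, so it has the same value in local coordinates of the submanifold
`M(κ) × I` and in the linear coordinates of `ℝ³ × ℝ` that are used here. -/
def IsLeviCivitaDeriv (κ : ℝ) (f : ℝ → ℝ) (φ V : S → AmbientSpace) (p : S)
    (X : TangentSpace (𝓡 2) p) (W : AmbientSpace) : Prop :=
  W ∈ ambientTangent κ (φ p) ∧
  ∀ Z ∈ ambientTangent κ (φ p),
    warpedMetric κ f (φ p) W Z =
      warpedMetric κ f (φ p) (surfaceDiff V p X) Z +
        (1 / 2) * (metricDeriv (warpedMetric κ f) (φ p) (surfaceDiff φ p X) (V p) Z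
          + metricDeriv (warpedMetric κ f) (φ p) (V p) (surfaceDiff φ p X) Z
          - metricDeriv (warpedMetric κ f) (φ p) Z (surfaceDiff φ p X) (V p))

/-- The smooth function `ϱ` is an umbilicity function of the immersion `φ` with unit normal `N`:
`ε ∇̄_X N = ϱ X` for all tangent vectors `X`. Here `ε ∈ {1, -1}` is the sign convention: with
`ε = 1` this is `∇̄_X N = ϱ X`, with `ε = -1` it is `S X = ϱ X` for the Weingarten operator
`S X = -∇̄_X N`. -/
structure IsUmbilicityFunction (ε κ : ℝ) (f : ℝ → ℝ) (φ N : S → AmbientSpace) (ϱ : S → ℝ) :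
    Prop where
  smooth : ContMDiff (𝓡 2) 𝓘(ℝ, ℝ) ∞ ϱ
  umbilical : ∀ p (X : TangentSpace (𝓡 2) p), ∃ W : AmbientSpace,
    IsLeviCivitaDeriv κ f φ N p X W ∧ ε • W = ϱ p • surfaceDiff φ p X

/-- `V` is the gradient at `p` of the function `h`, for the induced metric:
`g(V, X) = dh(X)` for all `X`. -/
def IsSurfaceGradient (κ : ℝ) (f : ℝ → ℝ) (φ : S → AmbientSpace) (h : S → ℝ) (p : S)
    (V : TangentSpace (𝓡 2) p) : Prop :=
  ∀ X : TangentSpace (𝓡 2) p, inducedMetric κ f φ p V X = surfaceDiffFun h p X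

/-- The chart `c = (u, v)` of the surface is isothermal, with induced metric
`(1/η) (du² + dv²)` and `η > 0`. -/
structure IsIsothermalChart (κ : ℝ) (f : ℝ → ℝ) (φ : S → AmbientSpace)
    (c : OpenPartialHomeomorph S (EuclideanSpace ℝ (Fin 2))) (η : S → ℝ) : Prop where
  mem_atlas : c ∈ IsManifold.maximalAtlas (𝓡 2) ∞ S
  pos : ∀ q ∈ c.source, 0 < η q
  conformal : ∀ q ∈ c.source, ∀ X Y : TangentSpace (𝓡 2) q,
    inducedMetric κ f φ q X Y =
      1 / η q * inner ℝ (chartDiff c q X) (chartDiff c q Y)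

end Surface

end

/-! The statement is a Codazzi equation, obtained without computing curvature. In the linear
coordinates of `ℝ³ × ℝ` only the factor `e^{2f}` of the metric varies. Write `q` for the position in
`M(κ)`, `N = (N₁, N₂)`, and `r` for the factor in `∇̄_X N = r X`. Umbilicity then reads `dN = a dφ +
dt ⊗ b`, with `a = r - f' N₂` and `b = (κ e^{-2f} N₂ q - f' N₁, 0)`
(`eq_of_covariantDeriv_eq_smul`).

Symmetry of second derivatives gives `da ∧ dφ = dt ∧ db` (`wedge_eq_of_fderiv_eq`). Substituting
`dN` again leaves `(dr - N₂ (f'' + κ e^{-2f}) dt) ∧ dφ = 0` (`umbilical_codazzi`). As `dφ` is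
injective on a plane, the scalar one-form vanishes (`eq_zero_of_smul_eq_smul`). Finally `N₂ = ν`,
and `dt` restricted to the surface is dual to `T`. -/

/-! ### The warped metric and the covariant derivative in linear coordinates. -/

theorem metricDeriv_warpedMetric {κ : ℝ} {f : ℝ → ℝ} {f' : ℝ} {x : AmbientSpace}
    (hf : HasDerivAt f f' x.2) (u v w : AmbientSpace) :
    metricDeriv (warpedMetric κ f) x u v w =
      2 * f' * u.2 * (Real.exp (2 * f x.2) * spaceFormMetric κ v.1 w.1) := by
  have h1 : HasFDerivAt (fun y : AmbientSpace => f y.2)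
      (f' • ContinuousLinearMap.snd ℝ (Fin 3 → ℝ) ℝ) x :=
    hf.comp_hasFDerivAt x hasFDerivAt_snd
  have h2 := ((h1.const_mul 2).exp.mul_const (spaceFormMetric κ v.1 w.1)).add_const (v.2 * w.2)
  unfold metricDeriv warpedMetric
  rw [h2.fderiv]
  simp
  ring

/-- The metric of the space form is positive definite on tangent vectors. -/
theorem spaceFormMetric_self_nonneg {κ : ℝ} (hκ : κ = -1 ∨ κ = 0 ∨ κ = 1) {q v : Fin 3 → ℝ}
    (hq : q ∈ spaceForm κ) (hv : κ * (q 0 * v 0 + q 1 * v 1) + q 2 * v 2 = 0) :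
    0 ≤ spaceFormMetric κ v v ∧ (spaceFormMetric κ v v = 0 → v = 0) := by
  obtain ⟨h1, h2⟩ := hq
  suffices H : 0 ≤ spaceFormMetric κ v v ∧
      (spaceFormMetric κ v v = 0 → v 0 = 0 ∧ v 1 = 0 ∧ v 2 = 0) by
    refine ⟨H.1, fun h => ?_⟩
    obtain ⟨a, b, c⟩ := H.2 h
    ext i
    fin_cases i <;> simpa
  unfold spaceFormMetric
  rcases hκ with rfl | rfl | rfl
  · have hz := h2 (by norm_num)
    -- Lagrange's identity, after eliminating `q 2 * v 2` by tangency and `q 2 ^ 2` by the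
    -- hyperboloid equation.
    have key : q 2 ^ 2 * (v 0 * v 0 + v 1 * v 1 + -1 * (v 2 * v 2)) =
        v 0 ^ 2 + v 1 ^ 2 + (q 0 * v 1 - q 1 * v 0) ^ 2 := by
      linear_combination (v 0 ^ 2 + v 1 ^ 2) * h1
        - (q 2 * v 2 + (q 0 * v 0 + q 1 * v 1)) * hv
    have hz2 : 0 < q 2 ^ 2 := by positivity
    refine ⟨?_, fun h => ?_⟩
    · refine nonneg_of_mul_nonneg_right ?_ hz2
      rw [key]
      positivity
    · rw [h] at key
      have a : v 0 = 0 := by nlinarith [sq_nonneg (v 1), sq_nonneg (q 0 * v 1 - q 1 * v 0)]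
      have b : v 1 = 0 := by nlinarith [sq_nonneg (v 0), sq_nonneg (q 0 * v 1 - q 1 * v 0)]
      refine ⟨a, b, ?_⟩
      rw [a, b] at hv
      have : q 2 * v 2 = 0 := by linarith
      exact (mul_eq_zero.1 this).resolve_left hz.ne'
  · have hz := h2 le_rfl
    have hv2 : v 2 = 0 := by
      have : q 2 * v 2 = 0 := by linarith
      exact (mul_eq_zero.1 this).resolve_left hz.ne'
    refine ⟨by nlinarith [sq_nonneg (v 0), sq_nonneg (v 1)], fun h => ⟨?_, ?_, hv2⟩⟩ <;>
      nlinarith [sq_nonneg (v 0), sq_nonneg (v 1)]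
  · refine ⟨by nlinarith [sq_nonneg (v 0), sq_nonneg (v 1), sq_nonneg (v 2)],
      fun h => ⟨?_, ?_, ?_⟩⟩ <;>
      nlinarith [sq_nonneg (v 0), sq_nonneg (v 1), sq_nonneg (v 2)]

theorem eq_zero_of_warpedMetric_self_eq_zero {κ : ℝ} (hκ : κ = -1 ∨ κ = 0 ∨ κ = 1) {f : ℝ → ℝ}
    {x v : AmbientSpace} (hx : x.1 ∈ spaceForm κ) (hv : v ∈ ambientTangent κ x)
    (h : warpedMetric κ f x v v = 0) : v = 0 := by
  obtain ⟨h1, h2⟩ := spaceFormMetric_self_nonneg hκ hx hv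
  unfold warpedMetric at h
  have hE := Real.exp_pos (2 * f x.2)
  have h3 := mul_nonneg hE.le h1
  have h4 := mul_self_nonneg v.2
  have h5 : Real.exp (2 * f x.2) * spaceFormMetric κ v.1 v.1 = 0 := by linarith
  refine Prod.ext (h2 ((mul_eq_zero.1 h5).resolve_left hE.ne')) ?_
  exact mul_self_eq_zero.1 (by linarith)

/-- If `∇̄_Y N = r Y` then the derivative `d` of `N` in the linear space `ℝ³ × ℝ` is
`(r - f' N₂) Y + Y₂ (κ e^{-2f} N₂ q - f' N₁, 0)`. -/
theorem eq_of_covariantDeriv_eq_smul {κ : ℝ} (hκ : κ = -1 ∨ κ = 0 ∨ κ = 1) {f : ℝ → ℝ} {f' r : ℝ}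
    {x n Y d : AmbientSpace} (hf : HasDerivAt f f' x.2) (hx : x.1 ∈ spaceForm κ)
    (hn : n ∈ ambientTangent κ x) (hY : Y ∈ ambientTangent κ x)
    (hd : κ * (Y.1 0 * n.1 0 + Y.1 1 * n.1 1) + Y.1 2 * n.1 2
      + (κ * (x.1 0 * d.1 0 + x.1 1 * d.1 1) + x.1 2 * d.1 2) = 0)
    (hnY : warpedMetric κ f x n Y = 0)
    (hK : ∀ Z ∈ ambientTangent κ x, warpedMetric κ f x (r • Y) Z = warpedMetric κ f x d Z +
        (1 / 2) * (metricDeriv (warpedMetric κ f) x Y n Z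
          + metricDeriv (warpedMetric κ f) x n Y Z - metricDeriv (warpedMetric κ f) x Z Y n)) :
    d = (r - f' * n.2) • Y +
      Y.2 • ((-f') • n.1 + (κ * Real.exp (-2 * f x.2) * n.2) • x.1, (0 : ℝ)) := by
  have hEE : Real.exp (2 * f x.2) * Real.exp (-2 * f x.2) = 1 := by
    rw [← Real.exp_add]; simp
  have hB : spaceFormMetric κ n.1 Y.1 = - Real.exp (-2 * f x.2) * (n.2 * Y.2) := by
    unfold warpedMetric at hnY
    linear_combination Real.exp (-2 * f x.2) * hnY - spaceFormMetric κ n.1 Y.1 * hEE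
  -- For `κ = ±1` this is `κ² = 1`; for `κ = 0` tangency forces `n.1 2 = 0`.
  have hL : κ * (Y.1 0 * n.1 0 + Y.1 1 * n.1 1) + Y.1 2 * n.1 2 =
      κ * spaceFormMetric κ n.1 Y.1 := by
    unfold spaceFormMetric
    rcases hκ with rfl | rfl | rfl
    · ring
    · have hz := hx.2 le_rfl
      have hv : x.1 2 * n.1 2 = 0 := by
        have : (0 : ℝ) * (x.1 0 * n.1 0 + x.1 1 * n.1 1) + x.1 2 * n.1 2 = 0 := hn
        linarith
      rw [(mul_eq_zero.1 hv).resolve_left hz.ne']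
      ring
    · ring
  -- The position vector is normal to the quadric; without the factor `κ` this fails in the flat
  -- case.
  have hq : ∀ Z ∈ ambientTangent κ x, κ * spaceFormMetric κ x.1 Z.1 = 0 := by
    intro Z hZ
    have hZ' : κ * (x.1 0 * Z.1 0 + x.1 1 * Z.1 1) + x.1 2 * Z.1 2 = 0 := hZ
    unfold spaceFormMetric
    rcases hκ with rfl | rfl | rfl
    · linear_combination hZ'
    · ring
    · linear_combination hZ'
  have hn' : κ * (x.1 0 * n.1 0 + x.1 1 * n.1 1) + x.1 2 * n.1 2 = 0 := hn
  have hY' : κ * (x.1 0 * Y.1 0 + x.1 1 * Y.1 1) + x.1 2 * Y.1 2 = 0 := hY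
  have hx1 := hx.1
  rw [← sub_eq_zero]
  set D := d - ((r - f' * n.2) • Y +
      Y.2 • ((-f') • n.1 + (κ * Real.exp (-2 * f x.2) * n.2) • x.1, (0 : ℝ))) with hD
  -- The coefficient of `x.1` is exactly what makes `D` tangent. The form is definite only on
  -- tangent vectors, so `D = 0` will follow by pairing `D` with itself.
  have hDt : D ∈ ambientTangent κ x := by
    simp only [ambientTangent, Set.mem_ofPred_eq, hD, Prod.fst_sub, Prod.fst_add, Prod.smul_fst,
      Pi.sub_apply, Pi.add_apply, Pi.smul_apply, smul_eq_mul]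
    linear_combination hd - hL - κ * hB - (r - f' * n.2) * hY' + Y.2 * f' * hn'
      - Y.2 * κ * Real.exp (-2 * f x.2) * n.2 * hx1
  have hDZ : ∀ Z ∈ ambientTangent κ x, warpedMetric κ f x D Z = 0 := by
    intro Z hZ
    have h1 := hK Z hZ
    have h2 := hq Z hZ
    simp only [metricDeriv_warpedMetric hf] at h1
    have hB' : spaceFormMetric κ Y.1 n.1 = - Real.exp (-2 * f x.2) * (n.2 * Y.2) := by
      rw [← hB]; unfold spaceFormMetric; ring
    rw [hB'] at h1
    simp only [warpedMetric, spaceFormMetric, hD, Prod.fst_sub, Prod.fst_add, Prod.smul_fst,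
      Pi.sub_apply, Pi.add_apply, Pi.smul_apply, smul_eq_mul, Prod.snd_sub, Prod.snd_add,
      Prod.smul_snd] at h1 h2 ⊢
    linear_combination - h1 - Y.2 * n.2 * Real.exp (2 * f x.2) * Real.exp (-2 * f x.2) * h2
      - f' * n.2 * Y.2 * Z.2 * hEE
  exact eq_zero_of_warpedMetric_self_eq_zero hκ hx hDt (hDZ D hDt)

/-! ### Integrability from symmetry of second derivatives. -/

theorem ContDiffAt.hasFDerivAt_fderiv_apply {E G : Type*} [NormedAddCommGroup E] [NormedSpace ℝ E]
    [NormedAddCommGroup G] [NormedSpace ℝ G] {g : E → G} {x : E} (hg : ContDiffAt ℝ 2 g x) (V : E) :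
    HasFDerivAt (fun y => fderiv ℝ g y V) ((fderiv ℝ (fderiv ℝ g) x).flip V) x := by
  have h1 : DifferentiableAt ℝ (fderiv ℝ g) x :=
    (hg.fderiv_right (m := 1) (by norm_num)).differentiableAt one_ne_zero
  convert h1.hasFDerivAt.clm_apply (hasFDerivAt_const V x) using 1
  ext
  simp

/-- The integrability condition of `dn = a dφ + dt ⊗ b`, obtained from the symmetry of second
derivatives: `da ∧ dφ = dt ∧ db`. -/
theorem wedge_eq_of_fderiv_eq {E F : Type*} [NormedAddCommGroup E] [NormedSpace ℝ E]
    [NormedAddCommGroup F] [NormedSpace ℝ F] {n φ b : E → F} {t a : E → ℝ} {x : E}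
    (hn : ContDiffAt ℝ 2 n x) (hφ : ContDiffAt ℝ 2 φ x) (ht : ContDiffAt ℝ 2 t x)
    (ha : DifferentiableAt ℝ a x) (hb : DifferentiableAt ℝ b x)
    (h : ∀ᶠ y in nhds x, ∀ X, fderiv ℝ n y X = a y • fderiv ℝ φ y X + fderiv ℝ t y X • b y)
    (X Y : E) :
    fderiv ℝ a x X • fderiv ℝ φ x Y - fderiv ℝ a x Y • fderiv ℝ φ x X =
      fderiv ℝ t x X • fderiv ℝ b x Y - fderiv ℝ t x Y • fderiv ℝ b x X := by
  have key (V W : E) : fderiv ℝ (fderiv ℝ n) x W V =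
      a x • fderiv ℝ (fderiv ℝ φ) x W V + fderiv ℝ a x W • fderiv ℝ φ x V +
        (fderiv ℝ t x V • fderiv ℝ b x W + fderiv ℝ (fderiv ℝ t) x W V • b x) := by
    have h1 := (ha.hasFDerivAt.smul (hφ.hasFDerivAt_fderiv_apply V)).add
      ((ht.hasFDerivAt_fderiv_apply V).smul hb.hasFDerivAt)
    have h2 := (hn.hasFDerivAt_fderiv_apply V).unique
      (h1.congr_of_eventuallyEq (h.mono fun y hy => hy V))
    simpa using congrArg (fun A => A W) h2
  have h3 := hn.isSymmSndFDerivAt (by simp) X Y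
  rw [key, key, hφ.isSymmSndFDerivAt (by simp) X Y, ht.isSymmSndFDerivAt (by simp) X Y] at h3
  linear_combination (norm := module) h3

/-! ### The Codazzi equation on an open set of a normed space. -/

section Coordinates

variable {E : Type*} [NormedAddCommGroup E] [NormedSpace ℝ E]

theorem hasFDerivAt_fst_apply {φ : E → AmbientSpace} {x : E} (h : DifferentiableAt ℝ φ x)
    (i : Fin 3) :
    HasFDerivAt (fun y => (φ y).1 i) ((ContinuousLinearMap.proj i).comp
      ((ContinuousLinearMap.fst ℝ (Fin 3 → ℝ) ℝ).comp (fderiv ℝ φ x))) x :=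
  ((ContinuousLinearMap.proj (R := ℝ) (φ := fun _ : Fin 3 => ℝ) i).comp
    (ContinuousLinearMap.fst ℝ (Fin 3 → ℝ) ℝ)).hasFDerivAt.comp x h.hasFDerivAt

/-- The derivative of a map into `M(κ) × I` is tangent to `M(κ) × I`. -/
theorem fderiv_mem_ambientTangent {κ : ℝ} {φ : E → AmbientSpace} {x : E}
    (h : DifferentiableAt ℝ φ x) (hS : ∀ᶠ y in nhds x, (φ y).1 ∈ spaceForm κ) (X : E) :
    fderiv ℝ φ x X ∈ ambientTangent κ (φ x) := by
  have h1 := ((((hasFDerivAt_fst_apply h 0).pow 2).add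
    ((hasFDerivAt_fst_apply h 1).pow 2)).const_mul κ).add ((hasFDerivAt_fst_apply h 2).pow 2)
  have h2 := h1.unique
    ((hasFDerivAt_const (1 : ℝ) x).congr_of_eventuallyEq (hS.mono fun y hy => hy.1))
  have h3 := congrArg (fun A => A X) h2
  simp at h3
  change κ * _ + _ = (0 : ℝ)
  linear_combination h3 / 2

/-- The derivative of the tangency equation of a vector field along a map into `M(κ) × I`. -/
theorem fderiv_tangency {κ : ℝ} {φ N : E → AmbientSpace} {x : E}
    (hφ : DifferentiableAt ℝ φ x) (hN : DifferentiableAt ℝ N x)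
    (hT : ∀ᶠ y in nhds x, N y ∈ ambientTangent κ (φ y)) (X : E) :
    κ * ((fderiv ℝ φ x X).1 0 * (N x).1 0 + (fderiv ℝ φ x X).1 1 * (N x).1 1)
      + (fderiv ℝ φ x X).1 2 * (N x).1 2
      + (κ * ((φ x).1 0 * (fderiv ℝ N x X).1 0 + (φ x).1 1 * (fderiv ℝ N x X).1 1)
        + (φ x).1 2 * (fderiv ℝ N x X).1 2) = 0 := by
  have h1 := ((((hasFDerivAt_fst_apply hφ 0).mul (hasFDerivAt_fst_apply hN 0)).add
    ((hasFDerivAt_fst_apply hφ 1).mul (hasFDerivAt_fst_apply hN 1))).const_mul κ).add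
    ((hasFDerivAt_fst_apply hφ 2).mul (hasFDerivAt_fst_apply hN 2))
  have h2 := h1.unique ((hasFDerivAt_const (0 : ℝ) x).congr_of_eventuallyEq hT)
  have h3 := congrArg (fun A => A X) h2
  simp at h3
  linear_combination h3

/-- The Codazzi equation of a totally umbilical map `φ`, in coordinates:
`(dr - N₂ (f'' + κ e^{-2f}) dt) ∧ dφ = 0`. -/
theorem umbilical_codazzi {κ : ℝ} (hκ : κ = -1 ∨ κ = 0 ∨ κ = 1) {I : Set ℝ} (hI : IsOpen I)
    {f : ℝ → ℝ} (hf : ContDiffOn ℝ ∞ f I) {U : Set E} (hU : IsOpen U)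
    {φ N : E → AmbientSpace} {r : E → ℝ} (hφ : ContDiffOn ℝ ∞ φ U) (hN : ContDiffOn ℝ ∞ N U)
    (hr : ContDiffOn ℝ ∞ r U) (hS : ∀ y ∈ U, (φ y).1 ∈ spaceForm κ) (hφI : ∀ y ∈ U, (φ y).2 ∈ I)
    (hT : ∀ y ∈ U, N y ∈ ambientTangent κ (φ y))
    (hn : ∀ y ∈ U, ∀ X, warpedMetric κ f (φ y) (N y) (fderiv ℝ φ y X) = 0)
    (hK : ∀ y ∈ U, ∀ X, ∀ Z ∈ ambientTangent κ (φ y),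
      warpedMetric κ f (φ y) (r y • fderiv ℝ φ y X) Z =
        warpedMetric κ f (φ y) (fderiv ℝ N y X) Z +
        (1 / 2) * (metricDeriv (warpedMetric κ f) (φ y) (fderiv ℝ φ y X) (N y) Z
          + metricDeriv (warpedMetric κ f) (φ y) (N y) (fderiv ℝ φ y X) Z
          - metricDeriv (warpedMetric κ f) (φ y) Z (fderiv ℝ φ y X) (N y)))
    {x : E} (hx : x ∈ U) (X Y : E) :
    (fderiv ℝ r x X - (N x).2 * (deriv (deriv f) (φ x).2 + κ * Real.exp (-2 * f (φ x).2)) *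
        (fderiv ℝ φ x X).2) • fderiv ℝ φ x Y =
      (fderiv ℝ r x Y - (N x).2 * (deriv (deriv f) (φ x).2 + κ * Real.exp (-2 * f (φ x).2)) *
        (fderiv ℝ φ x Y).2) • fderiv ℝ φ x X := by
  have hat {G : Type} [NormedAddCommGroup G] [NormedSpace ℝ G] {g : E → G}
      (hg : ContDiffOn ℝ ∞ g U) {y : E} (hy : y ∈ U) : ContDiffAt ℝ ∞ g y :=
    hg.contDiffAt (hU.mem_nhds hy)
  have hdf {G : Type} [NormedAddCommGroup G] [NormedSpace ℝ G] {g : E → G}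
      (hg : ContDiffOn ℝ ∞ g U) {y : E} (hy : y ∈ U) : DifferentiableAt ℝ g y :=
    (hat hg hy).differentiableAt (by simp)
  have hf1 {s : ℝ} (hs : s ∈ I) : HasDerivAt f (deriv f s) s :=
    ((hf.contDiffAt (hI.mem_nhds hs)).differentiableAt (by simp)).hasDerivAt
  have hf2 {s : ℝ} (hs : s ∈ I) : HasDerivAt (deriv f) (deriv (deriv f) s) s :=
    (((hf.deriv_of_isOpen hI (m := ∞) (by simp)).contDiffAt
      (hI.mem_nhds hs)).differentiableAt (by simp)).hasDerivAt
  have hev {P : E → Prop} {y : E} (hy : y ∈ U) (h : ∀ y ∈ U, P y) : ∀ᶠ y in nhds y, P y :=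
    Filter.eventually_of_mem (hU.mem_nhds hy) h
  have hsnd {g : E → AmbientSpace} (hg : ContDiffOn ℝ ∞ g U) {y : E} (hy : y ∈ U) :
      HasFDerivAt (fun y => (g y).2)
        ((ContinuousLinearMap.snd ℝ (Fin 3 → ℝ) ℝ).comp (fderiv ℝ g y)) y :=
    (hdf hg hy).hasFDerivAt.snd
  have hfst {g : E → AmbientSpace} (hg : ContDiffOn ℝ ∞ g U) {y : E} (hy : y ∈ U) :
      HasFDerivAt (fun y => (g y).1)
        ((ContinuousLinearMap.fst ℝ (Fin 3 → ℝ) ℝ).comp (fderiv ℝ g y)) y :=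
    (hdf hg hy).hasFDerivAt.fst
  have hdN : ∀ y ∈ U, ∀ X, fderiv ℝ N y X =
      (r y - deriv f (φ y).2 * (N y).2) • fderiv ℝ φ y X + fderiv ℝ (fun y => (φ y).2) y X •
        ((-deriv f (φ y).2) • (N y).1 + (κ * Real.exp (-2 * f (φ y).2) * (N y).2) • (φ y).1,
          (0 : ℝ)) := by
    intro y hy X
    rw [(hsnd hφ hy).fderiv]
    exact eq_of_covariantDeriv_eq_smul hκ (hf1 (hφI y hy)) (hS y hy) (hT y hy)
      (fderiv_mem_ambientTangent (hdf hφ hy) (hev hy hS) X)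
      (fderiv_tangency (hdf hφ hy) (hdf hN hy) (hev hy hT) X) (hn y hy X) (hK y hy X)
  have ht := hsnd hφ hx
  have hN2 := hsnd hN hx
  have hda := (hdf hr hx).hasFDerivAt.sub
    (((hf2 (hφI x hx)).comp_hasFDerivAt x ht).mul hN2)
  have hf' := (hf2 (hφI x hx)).comp_hasFDerivAt x ht
  have hexp := (((hf1 (hφI x hx)).comp_hasFDerivAt x ht).const_mul (-2)).exp.const_mul κ
  have hdb := ((hf'.neg.smul (hfst hN hx)).add ((hexp.mul hN2).smul (hfst hφ hx))).prodMk
    (hasFDerivAt_const (0 : ℝ) x)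
  have h2 : (2 : WithTop ℕ∞) ≤ ∞ := ENat.LEInfty.out
  have hw := wedge_eq_of_fderiv_eq ((hat hN hx).of_le h2) ((hat hφ hx).of_le h2)
    (((hat hφ hx).of_le h2).snd) hda.differentiableAt hdb.differentiableAt (hev hx hdN) X Y
  rw [hda.fderiv, hdb.fderiv, ht.fderiv] at hw
  have hX := hdN x hx X
  have hY := hdN x hx Y
  rw [ht.fderiv] at hX hY
  have hw1 := fun i => congrFun (congrArg Prod.fst hw) i
  have hw2 := congrArg Prod.snd hw
  have hX1 := fun i => congrFun (congrArg Prod.fst hX) i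
  have hX2 := congrArg Prod.snd hX
  have hY1 := fun i => congrFun (congrArg Prod.fst hY) i
  have hY2 := congrArg Prod.snd hY
  simp at hw1 hw2 hX1 hX2 hY1 hY2
  refine Prod.ext (funext fun i => ?_) ?_
  -- In `dt ∧ db` the `dt ∧ dt` terms cancel, `dt ∧ dN₂ = 0` because `dN₂ = a dt`, and `-f' dt ∧ dN₁
  -- = -f' a dt ∧ dq` matches the term `-f' dN₂` of `da`.
  · have w := hw1 i
    rw [hX1 i, hY1 i, hX2, hY2] at w
    simp only [Prod.smul_fst, Pi.smul_apply, smul_eq_mul, neg_mul]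
    linear_combination w
  -- The last component of `b` is zero, so this is just `da ∧ dt = 0`.
  · rw [hX2, hY2] at hw2
    simp only [Prod.smul_snd, smul_eq_mul]
    linear_combination hw2

end Coordinates

/-! ### Transfer to the surface through charts. -/

section Surface

variable {S : Type*} [TopologicalSpace S] [ChartedSpace (EuclideanSpace ℝ (Fin 2)) S]
  {c : OpenPartialHomeomorph S (EuclideanSpace ℝ (Fin 2))}

theorem mdifferentiable_of_mem_maximalAtlas (hc : c ∈ IsManifold.maximalAtlas (𝓡 2) ∞ S) :
    c.MDifferentiable (𝓡 2) (𝓡 2) :=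
  ⟨(contMDiffOn_of_mem_maximalAtlas hc).mdifferentiableOn (by simp),
    (contMDiffOn_symm_of_mem_maximalAtlas hc).mdifferentiableOn (by simp)⟩

theorem chartDiff_surjective (hc : c ∈ IsManifold.maximalAtlas (𝓡 2) ∞ S) {p : S}
    (hp : p ∈ c.source) : Function.Surjective (chartDiff c p) :=
  (mdifferentiable_of_mem_maximalAtlas hc).mfderiv_surjective hp

variable {V : Type*} [NormedAddCommGroup V] [NormedSpace ℝ V] {g : S → V}

theorem contDiffOn_comp_chart_symm (hc : c ∈ IsManifold.maximalAtlas (𝓡 2) ∞ S)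
    (hg : ContMDiff (𝓡 2) 𝓘(ℝ, V) ∞ g) : ContDiffOn ℝ ∞ (g ∘ c.symm) c.target :=
  (hg.comp_contMDiffOn (contMDiffOn_symm_of_mem_maximalAtlas hc)).contDiffOn

theorem fderiv_comp_chart_symm (hc : c ∈ IsManifold.maximalAtlas (𝓡 2) ∞ S)
    (hg : ContMDiff (𝓡 2) 𝓘(ℝ, V) ∞ g) {p : S} (hp : p ∈ c.source) (X : TangentSpace (𝓡 2) p) :
    fderiv ℝ (g ∘ c.symm) (c p) (chartDiff c p X) = mfderiv (𝓡 2) 𝓘(ℝ, V) g p X := by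
  have h1 : MDifferentiableAt (𝓡 2) 𝓘(ℝ, V) (g ∘ c.symm) (c p) :=
    (((contDiffOn_comp_chart_symm hc hg).contDiffAt (c.open_target.mem_nhds
      (c.map_source hp))).differentiableAt (by simp)).mdifferentiableAt
  have h2 := (mdifferentiable_of_mem_maximalAtlas hc).mdifferentiableAt hp
  have h3 : g =ᶠ[nhds p] (g ∘ c.symm) ∘ c :=
    Filter.eventually_of_mem (c.open_source.mem_nhds hp) fun y hy => by simp [c.left_inv hy]
  rw [h3.mfderiv_eq, mfderiv_comp p h1 h2, mfderiv_eq_fderiv]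
  rfl

/-- If `α X ≠ 0`, injectivity of `L` makes every `Y` a multiple of `X`, so the dimension is at most
one. -/
theorem eq_zero_of_smul_eq_smul {E F : Type*} [AddCommGroup E] [Module ℝ E]
    [AddCommGroup F] [Module ℝ F] (hE : 1 < Module.finrank ℝ E) {α : E → ℝ} {L : E →ₗ[ℝ] F}
    (hL : Function.Injective L) (h : ∀ X Y, α X • L Y = α Y • L X) (X : E) : α X = 0 := by
  by_contra hX
  refine absurd (finrank_le_one X fun Y => ⟨(α X)⁻¹ * α Y, hL ?_⟩) (not_le.2 hE)
  rw [map_smul, mul_smul, ← h X Y, smul_smul, inv_mul_cancel₀ hX, one_smul]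

variable {ε κ : ℝ} {f : ℝ → ℝ} {I : Set ℝ} {φ N : S → AmbientSpace} {ϱ : S → ℝ}

/-- `dϱ = ε ν (f'' + κ e^{-2f}) dt` on a totally umbilical surface. -/
theorem surfaceDiffFun_umbilicity [IsManifold (𝓡 2) ∞ S] (hκ : κ = -1 ∨ κ = 0 ∨ κ = 1)
    (hIo : IsOpen I)
    (hf : ContDiffOn ℝ ∞ f I) (hφ : IsSurfaceImmersion κ I φ) (hN : IsUnitNormalField κ f φ N)
    (hε : ε = 1 ∨ ε = -1) (hϱ : IsUmbilicityFunction ε κ f φ N ϱ) (p : S)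
    (X : TangentSpace (𝓡 2) p) :
    surfaceDiffFun ϱ p X = ε * ((N p).2 *
      (deriv (deriv f) (φ p).2 + κ * Real.exp (-2 * f (φ p).2))) * (surfaceDiff φ p X).2 := by
  have hεε : ε * ε = 1 := by rcases hε with rfl | rfl <;> norm_num
  set c := chartAt (EuclideanSpace ℝ (Fin 2)) p
  have hc : c ∈ IsManifold.maximalAtlas (𝓡 2) ∞ S := IsManifold.chart_mem_maximalAtlas p
  -- Since `ε² = 1`, both sign conventions become `∇̄_X N = (ε ϱ) X`.
  have hr : ContMDiff (𝓡 2) 𝓘(ℝ, ℝ) ∞ fun q => ε * ϱ q := contMDiff_const.mul hϱ.smooth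
  have hp : p ∈ c.source := mem_chart_source _ p
  have hpt : ∀ P : EuclideanSpace ℝ (Fin 2) → Prop, (∀ q ∈ c.source, P (c q)) →
      ∀ y ∈ c.target, P y := fun P h y hy => by
    simpa [c.right_inv hy] using h _ (c.map_target hy)
  have hdφ {q : S} (hq : q ∈ c.source) (Y : TangentSpace (𝓡 2) q) :
      fderiv ℝ (φ ∘ c.symm) (c q) (chartDiff c q Y) = surfaceDiff φ q Y :=
    fderiv_comp_chart_symm hc hφ.smooth hq Y
  have hdN {q : S} (hq : q ∈ c.source) (Y : TangentSpace (𝓡 2) q) :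
      fderiv ℝ (N ∘ c.symm) (c q) (chartDiff c q Y) = surfaceDiff N q Y :=
    fderiv_comp_chart_symm hc hN.smooth hq Y
  have key := umbilical_codazzi hκ hIo hf c.open_target
    (contDiffOn_comp_chart_symm hc hφ.smooth) (contDiffOn_comp_chart_symm hc hN.smooth)
    (contDiffOn_comp_chart_symm hc hr) (fun y _ => hφ.mem_spaceForm _)
    (fun y _ => hφ.mem_interval _) (fun y _ => hN.tangent _)
    (hpt _ fun q hq V => by
      obtain ⟨Y, rfl⟩ := chartDiff_surjective hc hq V
      rw [hdφ hq]
      simpa [c.left_inv hq] using hN.normal q Y)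
    (hpt _ fun q hq V Z hZ => by
      obtain ⟨Y, rfl⟩ := chartDiff_surjective hc hq V
      obtain ⟨W, ⟨-, hW⟩, hWϱ⟩ := hϱ.umbilical q Y
      rw [hdφ hq, hdN hq]
      simp only [Function.comp_apply, c.left_inv hq] at hZ ⊢
      rw [← hW Z hZ, mul_smul, ← hWϱ, smul_smul, hεε, one_smul])
    (c.map_source hp)
  have hα := eq_zero_of_smul_eq_smul (E := TangentSpace (𝓡 2) p)
    (L := (mfderiv (𝓡 2) 𝓘(ℝ, AmbientSpace) φ p).toLinearMap)
    (α := fun Y => ε * surfaceDiffFun ϱ p Y - (N p).2 *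
      (deriv (deriv f) (φ p).2 + κ * Real.exp (-2 * f (φ p).2)) * (surfaceDiff φ p Y).2)
    (by
      change 1 < Module.finrank ℝ (EuclideanSpace ℝ (Fin 2))
      simp) (hφ.injective_diff p) (fun Y Z => by
      have h := key (chartDiff c p Y) (chartDiff c p Z)
      have hdr (Y : TangentSpace (𝓡 2) p) :
          fderiv ℝ ((fun q => ε * ϱ q) ∘ c.symm) (c p) (chartDiff c p Y) =
            ε * surfaceDiffFun ϱ p Y := by
        have h1 := ((contDiffOn_comp_chart_symm hc hϱ.smooth).contDiffAt (c.open_target.mem_nhds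
          (c.map_source hp))).differentiableAt (by simp)
        have h2 := (h1.hasFDerivAt.const_mul ε).fderiv
        change fderiv ℝ (fun y => ε * (ϱ ∘ c.symm) y) (c p) _ = _
        rw [h2]
        exact congrArg (ε * ·) (fderiv_comp_chart_symm hc hϱ.smooth hp Y)
      rw [hdr, hdr, hdφ hp, hdφ hp] at h
      simp only [Function.comp_apply, c.left_inv hp] at h
      exact h) X
  have : ε * surfaceDiffFun ϱ p X - (N p).2 *
      (deriv (deriv f) (φ p).2 + κ * Real.exp (-2 * f (φ p).2)) * (surfaceDiff φ p X).2 = 0 := hα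
  linear_combination ε * this - surfaceDiffFun ϱ p X * hεε

/-- A smooth function with vanishing differential is locally constant. -/
theorem isLocallyConstant_of_mfderiv_eq_zero [IsManifold (𝓡 2) ∞ S]
    (hg : ContMDiff (𝓡 2) 𝓘(ℝ, V) ∞ g)
    (h : ∀ p, mfderiv (𝓡 2) 𝓘(ℝ, V) g p = 0) : IsLocallyConstant g := by
  rw [IsLocallyConstant.iff_eventually_eq]
  intro p
  set c := chartAt (EuclideanSpace ℝ (Fin 2)) p
  have hc : c ∈ IsManifold.maximalAtlas (𝓡 2) ∞ S := IsManifold.chart_mem_maximalAtlas p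
  have hp : p ∈ c.source := mem_chart_source _ p
  obtain ⟨r, hr, hball⟩ := Metric.isOpen_iff.1 c.open_target (c p) (c.map_source hp)
  have hd : Set.EqOn (fderiv ℝ (g ∘ c.symm)) 0 (Metric.ball (c p) r) := by
    intro y hy
    have hs := c.map_target (hball hy)
    ext W
    obtain ⟨X, rfl⟩ := chartDiff_surjective hc hs W
    have h1 := fderiv_comp_chart_symm hc hg hs X
    rw [c.right_inv (hball hy), h] at h1
    exact h1
  have hnear : c ⁻¹' Metric.ball (c p) r ∈ nhds p :=
    (c.continuousAt hp).preimage_mem_nhds (Metric.ball_mem_nhds _ hr)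
  filter_upwards [hnear, c.open_source.mem_nhds hp] with q hq hqs
  have := Metric.isOpen_ball.is_const_of_fderiv_eq_zero
    (convex_ball (c p) r).isPreconnected
    (((contDiffOn_comp_chart_symm hc hg).mono hball).differentiableOn (by simp)) hd hq
    (Metric.mem_ball_self hr)
  simpa [c.left_inv hqs, c.left_inv hp] using this

end Surface

/-! ### The gradient formulas and constancy. -/

theorem lemma3 {S : Type*} [TopologicalSpace S] [ChartedSpace (EuclideanSpace ℝ (Fin 2)) S]
    [IsManifold (𝓡 2) ∞ S]
    (κ : ℝ) (hκ : κ = -1 ∨ κ = 0 ∨ κ = 1)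
    (I : Set ℝ) (hIo : IsOpen I) (hIc : I.OrdConnected)
    (f : ℝ → ℝ) (hf : ContDiffOn ℝ ∞ f I)
    (φ N : S → AmbientSpace)
    (hφ : IsSurfaceImmersion κ I φ) (hN : IsUnitNormalField κ f φ N)
    (ν : S → ℝ) (T : ∀ p : S, TangentSpace (𝓡 2) p)
    (hT : ∀ p, verticalField = surfaceDiff φ p (T p) + ν p • N p)
    (ε : ℝ) (hε : ε = 1 ∨ ε = -1)
    (ϱ : S → ℝ) (hϱ : IsUmbilicityFunction ε κ f φ N ϱ) :
    (∀ p : S, IsSurfaceGradient κ f φ ϱ p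
      ((ε * (ν p * (deriv (deriv f) (φ p).2 + κ * Real.exp (-2 * f (φ p).2)))) • T p)) ∧
    (∀ (c : OpenPartialHomeomorph S (EuclideanSpace ℝ (Fin 2))) (η : S → ℝ),
      IsIsothermalChart κ f φ c η → ∀ p ∈ c.source,
        η p • gradient (ϱ ∘ c.symm) (c p) =
          (ε * (ν p * (deriv (deriv f) (φ p).2 + κ * Real.exp (-2 * f (φ p).2)))) •
            chartDiff c p (T p)) ∧
    (ConnectedSpace S →
      (∀ p : S, deriv (deriv f) (φ p).2 + κ * Real.exp (-2 * f (φ p).2) = 0) →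
        ∃ r : ℝ, ∀ p : S, ϱ p = r) := by
  have hdϱ := surfaceDiffFun_umbilicity hκ hIo hf hφ hN hε hϱ
  -- Pair the decomposition of `∂_t` with `N` and with `dφ(X)`; pairing any vector with `∂_t` gives
  -- its height component.
  have hG (p : S) : ν p = (N p).2 ∧
      ∀ X : TangentSpace (𝓡 2) p, inducedMetric κ f φ p (T p) X = (surfaceDiff φ p X).2 := by
    have hT1 := fun i => congrFun (congrArg Prod.fst (hT p)) i
    have hT2 := congrArg Prod.snd (hT p)
    have hu := hN.unit p
    have h0 := hN.normal p (T p)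
    simp only [verticalField, Prod.fst_add, Prod.snd_add, Prod.smul_fst, Prod.smul_snd,
      Pi.add_apply, Pi.smul_apply, Pi.zero_apply, smul_eq_mul] at hT1 hT2
    simp only [inducedMetric, warpedMetric, spaceFormMetric] at h0 hu ⊢
    refine ⟨?_, fun X => ?_⟩
    · linear_combination - ν p * hu - h0 - (N p).2 * hT2 - Real.exp (2 * f (φ p).2) *
        ((N p).1 0 * hT1 0 + (N p).1 1 * hT1 1 + κ * (N p).1 2 * hT1 2)
    · have hX := hN.normal p X
      simp only [warpedMetric, spaceFormMetric] at hX
      linear_combination - ν p * hX - (surfaceDiff φ p X).2 * hT2 - Real.exp (2 * f (φ p).2) *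
        ((surfaceDiff φ p X).1 0 * hT1 0 + (surfaceDiff φ p X).1 1 * hT1 1
          + κ * (surfaceDiff φ p X).1 2 * hT1 2)
  refine ⟨fun p X => ?_, fun c η hc p hp => ?_, fun _ h0 => ?_⟩
  · rw [hdϱ, ← (hG p).2 X, ← (hG p).1]
    set a := ε * (ν p * (deriv (deriv f) (φ p).2 + κ * Real.exp (-2 * f (φ p).2)))
    have hs : surfaceDiff φ p (a • T p) = a • surfaceDiff φ p (T p) := map_smul _ _ _
    simp only [inducedMetric, warpedMetric, spaceFormMetric, hs, Prod.smul_fst, Prod.smul_snd,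
      Pi.smul_apply, smul_eq_mul]
    ring
  · refine ext_inner_right ℝ fun w => ?_
    obtain ⟨X, rfl⟩ := chartDiff_surjective hc.mem_atlas hp w
    have hd : DifferentiableAt ℝ (ϱ ∘ c.symm) (c p) :=
      ((contDiffOn_comp_chart_symm hc.mem_atlas hϱ.smooth).contDiffAt (c.open_target.mem_nhds
        (c.map_source hp))).differentiableAt (by simp)
    have h1 : inner ℝ (gradient (ϱ ∘ c.symm) (c p)) (chartDiff c p X) = surfaceDiffFun ϱ p X := by
      rw [gradient, InnerProductSpace.toDual_symm_apply]
      exact fderiv_comp_chart_symm hc.mem_atlas hϱ.smooth hp X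
    -- The Euclidean gradient in the chart is dual to `dϱ` for `du² + dv²`; the factor `η` undoes
    -- the `1/η` of the induced metric.
    rw [inner_smul_left, inner_smul_left, h1, hdϱ, ← (hG p).2 X, ← (hG p).1,
      hc.conformal p hp]
    have := (hc.pos p hp).ne'
    simp only [conj_trivial]
    field_simp
  · have hc : IsLocallyConstant ϱ := by
      refine isLocallyConstant_of_mfderiv_eq_zero hϱ.smooth fun p => ?_
      ext X
      have := hdϱ p X
      rw [h0, mul_zero, mul_zero, zero_mul] at this
      exact this
    obtain ⟨p₀⟩ := (inferInstance : Nonempty S)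
    exact ⟨ϱ p₀, fun p => hc.apply_eq_of_preconnectedSpace p p₀⟩
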